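/- Let $A \supseteq C$ be a ring extension (rings associative with $1$), where $C$ is a division ring and $A$ is an augmented ring, i.e. there is a ring homomorphism from $A$ to some division ring. For an intermediate ring $C \subseteq B \subseteq A$, call $B$ (more precisely the tower $A \supseteq B \supseteq C$) left D3 if $A \otimes_B A$ is isomorphic, as a $C$-$A$-bimodule, to a direct summand of a finite direct sum $A^N$, and right D3 if the same holds for $A$-$C$-bimodules. Assume that $A \supseteq C$ is of depth two, i.e. $B = C$ is both left and right D3. Let $V = A^C$ be the centralizer of $C$ in $A$, and let $S = \operatorname{End}({}_C A_C)$ be the ring of $C$-$C$-bimodule endomorphisms of $A$ under composition, with its left $V$-bialgebroid structure: the $V$-bimodule structure is $v\cdot\alpha\cdot w = v\,\alpha(-)\,w$, and the comultiplication is $$\Delta : S \to S \otimes_V S,\qquad \Delta(\beta) = \sum_k \gamma_k \otimes_V u_k^1\,\beta(u_k^2\,-),$$ where $\gamma_k \in S$ and $u_k = u_k^1 \otimes u_k^2 \in (A \otimes_C A)^C$ (summation understood) are right D2 quasibases, i.e. finitely many elements with $x \otimes y = \sum_k x\gamma_k(y)u_k$ for all $x,y \in A$. Such quasibases exist, and $\Delta$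 does not depend on their choice. A left coideal subring of $S$ is a subring $\mathcal J \subseteq S$ that is a left $V$-submodule and satisfies $\Delta(\mathcal J) \subseteq S \otimes_V \mathcal J$ (the image in $S\otimes_V S$). It is called Galois if 1. ${}_V\mathcal J$ is finitely generated projective, and 2. the only left ideals $I$ of $A$ with $\alpha(I) \subseteq I$ for all $\alpha \in \mathcal J$ are $0$ and $A$. Suppose that the right $V$-module $A_V$ is faithfully flat. Then the assignments $$B \longmapsto \operatorname{End}({}_C A_B), \qquad \mathcal J \longmapsto A^{\mathcal J} = \{x \in A : \alpha(x) = \alpha(1)\,x \text{ for all } \alpha \in \mathcal J\}$$ are mutually inverse, inclusion-reversing bijections between the set of left D3 intermediate division rings $C \subseteq B \subseteq A$ and the set of Galois left coideal subrings of $S$. (Here $\operatorname{End}({}_C A_B)$ denotes the ring of additive maps $A \to A$ that are left $C$-linear and right $B$-linear.) -/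

import Mathlib

open MulOpposite
open scoped TensorProduct

universe u

namespace DepthThree

/-! ### Tensor products over a noncommutative ring -/

section Tensor

variable (R M N : Type*) [Ring R] [AddCommGroup M] [Module Rᵐᵒᵖ M] [AddCommGroup N] [Module R N]

/-- The relations `(m r) ⊗ n = m ⊗ (r n)`. -/
def balancedRelations : AddSubgroup (M ⊗[ℤ] N) :=
  AddSubgroup.closure
    {t | ∃ (m : M) (r : R) (n : N), t = (op r • m) ⊗ₜ[ℤ] n - m ⊗ₜ[ℤ] (r • n)}

/-- The tensor product `M ⊗_R N` of a right `R`-module `M` and a left `R`-module `N` over an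
arbitrary ring `R`; an abelian group. -/
def NCTensor : Type _ := (M ⊗[ℤ] N) ⧸ balancedRelations R M N

instance : AddCommGroup (NCTensor R M N) :=
  inferInstanceAs (AddCommGroup ((M ⊗[ℤ] N) ⧸ balancedRelations R M N))

namespace NCTensor

variable {M N}

/-- The quotient map `M ⊗_ℤ N → M ⊗_R N`. -/
def mk : M ⊗[ℤ] N →+ NCTensor R M N := QuotientAddGroup.mk' (balancedRelations R M N)

/-- The pure tensor `m ⊗ n` in `M ⊗_R N`. -/
def tmul (m : M) (n : N) : NCTensor R M N := mk R (m ⊗ₜ[ℤ] n)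

theorem add_tmul (m m' : M) (n : N) : tmul R (m + m') n = tmul R m n + tmul R m' n := by
  rw [tmul, TensorProduct.add_tmul, map_add]; rfl

theorem tmul_add (m : M) (n n' : N) : tmul R m (n + n') = tmul R m n + tmul R m n' := by
  rw [tmul, TensorProduct.tmul_add, map_add]; rfl

variable {R} in
theorem smul_tmul (r : R) (m : M) (n : N) : tmul R (op r • m) n = tmul R m (r • n) := by
  refine (QuotientAddGroup.eq_iff_sub_mem).2 ?_
  exact AddSubgroup.subset_closure ⟨m, r, n, rfl⟩

variable {R} in
theorem induction_on {p : NCTensor R M N → Prop} (t : NCTensor R M N)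
    (zero : p 0) (tmul : ∀ m n, p (tmul R m n)) (add : ∀ s t, p s → p t → p (s + t)) : p t := by
  obtain ⟨t, rfl⟩ := QuotientAddGroup.mk'_surjective (balancedRelations R M N) t
  induction t using TensorProduct.induction_on with
  | zero => rw [map_zero]; exact zero
  | tmul m n => exact tmul m n
  | add s t hs ht => rw [map_add]; exact add _ _ hs ht

variable {R} in
/-- The homomorphism out of `M ⊗_R N` given by an `R`-balanced biadditive map. -/
def lift {P : Type*} [AddCommGroup P] (f : M →+ N →+ P)
    (hf : ∀ (m : M) (r : R) (n : N), f (op r • m) n = f m (r • n)) : NCTensor R M N →+ P :=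
  QuotientAddGroup.lift (balancedRelations R M N)
    (TensorProduct.liftAddHom f (fun z m n => by simp)) (by
      rw [balancedRelations, AddSubgroup.closure_le]
      rintro _ ⟨m, r, n, rfl⟩
      simp [hf])

variable {R} in
@[simp]
theorem lift_tmul {P : Type*} [AddCommGroup P] (f : M →+ N →+ P)
    (hf : ∀ (m : M) (r : R) (n : N), f (op r • m) n = f m (r • n)) (m : M) (n : N) :
    lift f hf (tmul R m n) = f m n := by
  rfl

/-- Functoriality: `f ⊗ g : M ⊗_R N → M' ⊗_R N'`. -/
def map {M' N' : Type*} [AddCommGroup M'] [Module Rᵐᵒᵖ M'] [AddCommGroup N'] [Module R N']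
    (f : M →ₗ[Rᵐᵒᵖ] M') (g : N →ₗ[R] N') : NCTensor R M N →+ NCTensor R M' N' :=
  lift
    (AddMonoidHom.mk'
      (fun m => AddMonoidHom.mk' (fun n => tmul R (f m) (g n))
        (fun n n' => by rw [map_add, tmul_add]))
      (fun m m' => by
        ext n
        change tmul R (f (m + m')) (g n) = tmul R (f m) (g n) + tmul R (f m') (g n)
        rw [map_add, add_tmul]))
    (fun m r n => by
      change tmul R (f (op r • m)) (g n) = tmul R (f m) (g (r • n))
      rw [map_smul, map_smul, smul_tmul])

end NCTensor

/-- A right module `M` over a (possibly noncommutative) ring `R` is faithfully flat when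
`M ⊗_R -` preserves and reflects exactness of sequences of left `R`-modules. -/
def RightFaithfullyFlat (R : Type u) (M : Type u) [Ring R] [AddCommGroup M] [Module Rᵐᵒᵖ M] :
    Prop :=
  ∀ (X Y Z : Type u) [AddCommGroup X] [AddCommGroup Y] [AddCommGroup Z]
    [Module R X] [Module R Y] [Module R Z] (f : X →ₗ[R] Y) (g : Y →ₗ[R] Z),
    Function.Exact f g ↔
      Function.Exact (NCTensor.map R (LinearMap.id : M →ₗ[Rᵐᵒᵖ] M) f)
        (NCTensor.map R (LinearMap.id : M →ₗ[Rᵐᵒᵖ] M) g)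

end Tensor

/-! ### Depth two and depth three -/

variable {A : Type u} [Ring A]

/-- A ring is a right module over each of its subrings, by right multiplication. -/
instance rightModuleSubring (B : Subring A) : Module (↥B)ᵐᵒᵖ A :=
  Module.compHom A (RingHom.op B.subtype)

theorem op_smul_eq (B : Subring A) (b : B) (x : A) : op b • x = x * (b : A) := rfl

/-- A subring that is a division ring. -/
def IsDivisionSubring (B : Subring A) : Prop :=
  (1 : A) ≠ 0 ∧ ∀ x ∈ B, x ≠ 0 → ∃ y ∈ B, x * y = 1 ∧ y * x = 1

/-- The tensor-square `A ⊗_B A` of a ring extension `A ⊇ B`. -/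
abbrev TensorSq (B : Subring A) : Type u := NCTensor (↥B) A A

namespace TensorSq

variable (B : Subring A)

/-- Left multiplication by `a` on `A ⊗_B A`: `a (x ⊗ y) = (a x) ⊗ y`. -/
def lmul (a : A) : TensorSq B →+ TensorSq B :=
  NCTensor.map (↥B)
    { toFun := fun x => a * x
      map_add' := mul_add a
      map_smul' := fun b x => (mul_assoc a x (b.unop : A)).symm } LinearMap.id

/-- Right multiplication by `a` on `A ⊗_B A`: `(x ⊗ y) a = x ⊗ (y a)`. -/
def rmul (a : A) : TensorSq B →+ TensorSq B :=
  NCTensor.map (↥B) LinearMap.id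
    { toFun := fun x => x * a
      map_add' := fun x y => add_mul x y a
      map_smul' := fun b x => mul_assoc (b : A) x a }

theorem lmul_tmul (a x y : A) :
    lmul B a (NCTensor.tmul (↥B) x y) = NCTensor.tmul (↥B) (a * x) y := rfl

theorem rmul_tmul (a x y : A) :
    rmul B a (NCTensor.tmul (↥B) x y) = NCTensor.tmul (↥B) x (y * a) := rfl

end TensorSq

/-- For subrings `L`, `R` of `A`: as an `L`-`R`-bimodule, `A ⊗_B A` is isomorphic to a direct
summand of a finite direct sum `A^N`, that is, there are bimodule homomorphisms
`σ : A ⊗_B A → A^N` and `π : A^N → A ⊗_B A` with `π ∘ σ = id`. -/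
def TensorSqSummand (B L R : Subring A) : Prop :=
  ∃ (N : ℕ) (σ : TensorSq B →+ (Fin N → A)) (π : (Fin N → A) →+ TensorSq B),
    (∀ l ∈ L, ∀ t i, σ (TensorSq.lmul B l t) i = l * σ t i) ∧
    (∀ r ∈ R, ∀ t i, σ (TensorSq.rmul B r t) i = σ t i * r) ∧
    (∀ l ∈ L, ∀ f : Fin N → A, π (fun i => l * f i) = TensorSq.lmul B l (π f)) ∧
    (∀ r ∈ R, ∀ f : Fin N → A, π (fun i => f i * r) = TensorSq.rmul B r (π f)) ∧
    ∀ t, π (σ t) = t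

/-- The tower `A ⊇ B ⊇ C` is right depth three: `A ⊗_B A` is an `A`-`C`-bimodule direct summand of
some `A^N`. -/
def IsRightD3 (C B : Subring A) : Prop := TensorSqSummand B ⊤ C

/-- The tower `A ⊇ B ⊇ C` is left depth three: `A ⊗_B A` is a `C`-`A`-bimodule direct summand of
some `A^N`. -/
def IsLeftD3 (C B : Subring A) : Prop := TensorSqSummand B C ⊤

/-- The extension `A ⊇ C` is right depth two. -/
def IsRightD2 (C : Subring A) : Prop := IsRightD3 C C

/-- The extension `A ⊇ C` is left depth two. -/
def IsLeftD2 (C : Subring A) : Prop := IsLeftD3 C C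

/-- The extension `A ⊇ C` is depth two. -/
structure IsD2 (C : Subring A) : Prop where
  left : IsLeftD2 C
  right : IsRightD2 C

/-! ### Endomorphism rings -/

/-- `End(_C A_B)`: the ring, under composition, of additive maps `A → A` that are left `C`-linear
and right `B`-linear. -/
def bimodEnd (C B : Subring A) : Subring (AddMonoid.End A) where
  carrier := {f | (∀ c ∈ C, ∀ x, f (c * x) = c * f x) ∧ ∀ b ∈ B, ∀ x, f (x * b) = f x * b}
  one_mem' := ⟨fun _ _ _ => rfl, fun _ _ _ => rfl⟩
  zero_mem' := ⟨fun _ _ _ => by simp, fun _ _ _ => by simp⟩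
  mul_mem' := fun {f g} hf hg =>
    ⟨fun c hc x => by
        change f (g (c * x)) = c * f (g x)
        rw [hg.1 c hc, hf.1 c hc],
      fun b hb x => by
        change f (g (x * b)) = f (g x) * b
        rw [hg.2 b hb, hf.2 b hb]⟩
  add_mem' := fun {f g} hf hg =>
    ⟨fun c hc x => by
        change f (c * x) + g (c * x) = c * (f x + g x)
        rw [hg.1 c hc, hf.1 c hc, mul_add],
      fun b hb x => by
        change f (x * b) + g (x * b) = (f x + g x) * b
        rw [hg.2 b hb, hf.2 b hb, add_mul]⟩
  neg_mem' := fun {f} hf =>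
    ⟨fun c hc x => by
        change -f (c * x) = c * -f x
        rw [hf.1 c hc, mul_neg],
      fun b hb x => by
        change -f (x * b) = -f x * b
        rw [hf.2 b hb, neg_mul]⟩

variable (C : Subring A)

/-- The centralizer `V = A^C`. -/
abbrev V : Subring A := Subring.centralizer (C : Set A)

/-- `S = End(_C A_C)`. -/
abbrev S : Subring (AddMonoid.End A) := bimodEnd C C

/-! ### The left `V`-bialgebroid `S`

The structure maps of the bialgebroid are `source`, `target`, `comul` and `counit`; the
`V`-bimodule structure of `S` is `v · α · w = source v * target w * α = v α(-) w`. -/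

/-- The source map `V → S`, `v ↦ (x ↦ v x)`. -/
def source : V C →+* S C where
  toFun v := ⟨AddMonoidHom.mulLeft (v : A), by
    refine ⟨fun c hc x => ?_, fun c hc x => (mul_assoc _ _ _).symm⟩
    change (v : A) * (c * x) = c * ((v : A) * x)
    rw [← mul_assoc, ← mul_assoc, Subring.mem_centralizer_iff.1 v.2 c hc]⟩
  map_one' := by ext x; exact one_mul x
  map_zero' := by ext x; exact zero_mul x
  map_mul' v w := by ext x; exact mul_assoc (v : A) w x
  map_add' v w := by ext x; exact add_mul (v : A) w x

/-- The target map `V^op → S`, `v ↦ (x ↦ x v)`. -/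
def target : (V C)ᵐᵒᵖ →+* S C where
  toFun v := ⟨AddMonoidHom.mulRight (v.unop : A), by
    refine ⟨fun c hc x => mul_assoc _ _ _, fun c hc x => ?_⟩
    change x * c * (v.unop : A) = x * (v.unop : A) * c
    rw [mul_assoc, mul_assoc, Subring.mem_centralizer_iff.1 v.unop.2 c hc]⟩
  map_one' := by ext x; exact mul_one x
  map_zero' := by ext x; exact mul_zero x
  map_mul' v w := by ext x; exact (mul_assoc x (w.unop : A) v.unop).symm
  map_add' v w := by ext x; exact mul_add x (v.unop : A) w.unop

/-- The left `V`-module structure `v · α = v α(-)` of `S`. -/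
instance leftModuleS : Module (V C) (S C) := Module.compHom (S C) (source C)

/-- The right `V`-module structure `α · v = α(-) v` of `S`. -/
instance rightModuleS : Module (V C)ᵐᵒᵖ (S C) := Module.compHom (S C) (target C)

theorem smul_apply (v : V C) (α : S C) (x : A) :
    ((v • α : S C) : AddMonoid.End A) x = (v : A) * (α : AddMonoid.End A) x := rfl

theorem op_smul_apply (v : V C) (α : S C) (x : A) :
    ((op v • α : S C) : AddMonoid.End A) x = (α : AddMonoid.End A) x * (v : A) := rfl

/-- `S ⊗_V S`. -/
abbrev STensorS : Type u := NCTensor (V C) (S C) (S C)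

/-- The centralizer `(A ⊗_C A)^C`. -/
def tensorSqCentralizer : AddSubgroup (TensorSq C) where
  carrier := {u | ∀ c ∈ C, TensorSq.lmul C c u = TensorSq.rmul C c u}
  zero_mem' := fun c _ => by simp
  add_mem' := fun {s t} hs ht c hc => by rw [map_add, map_add, hs c hc, ht c hc]
  neg_mem' := fun {s} hs c hc => by rw [map_neg, map_neg, hs c hc]

variable {C}

/-- For `β : S` and `u ∈ A ⊗_C A`, the additive map `x ↦ u¹ β(u² x)`. -/
def insertHom (β : S C) : TensorSq C →+ (A →+ A) :=
  NCTensor.lift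
    (AddMonoidHom.mk'
      (fun a => AddMonoidHom.mk'
        (fun a' => (AddMonoidHom.mulLeft a).comp
          ((β : AddMonoid.End A).comp (AddMonoidHom.mulLeft a')))
        (fun a' a'' => by
          ext x
          change a * (β : AddMonoid.End A) ((a' + a'') * x) =
            a * (β : AddMonoid.End A) (a' * x) + a * (β : AddMonoid.End A) (a'' * x)
          rw [add_mul, map_add, mul_add]))
      (fun a b => by ext a' x; exact add_mul a b _))
    (fun a c a' => by
      ext x
      change a * (c : A) * (β : AddMonoid.End A) (a' * x) =
        a * (β : AddMonoid.End A) ((c : A) * a' * x)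
      rw [mul_assoc (c : A), β.2.1 c c.2, mul_assoc])

theorem insertHom_tmul (β : S C) (a a' x : A) :
    insertHom β (NCTensor.tmul (↥C) a a') x = a * (β : AddMonoid.End A) (a' * x) := rfl

theorem insertHom_lmul (β : S C) (c : A) (u : TensorSq C) (x : A) :
    insertHom β (TensorSq.lmul C c u) x = c * insertHom β u x := by
  induction u using NCTensor.induction_on with
  | zero => simp
  | tmul a a' => rw [TensorSq.lmul_tmul, insertHom_tmul, insertHom_tmul, mul_assoc]
  | add s t hs ht => simp only [map_add, AddMonoidHom.add_apply, hs, ht, mul_add]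

theorem insertHom_rmul (β : S C) (c : A) (u : TensorSq C) (x : A) :
    insertHom β (TensorSq.rmul C c u) x = insertHom β u (c * x) := by
  induction u using NCTensor.induction_on with
  | zero => simp
  | tmul a a' => rw [TensorSq.rmul_tmul, insertHom_tmul, insertHom_tmul, mul_assoc]
  | add s t hs ht => simp only [map_add, AddMonoidHom.add_apply, hs, ht]

theorem insertHom_mul_right (β : S C) (c : A) (hc : c ∈ C) (u : TensorSq C) (x : A) :
    insertHom β u (x * c) = insertHom β u x * c := by
  induction u using NCTensor.induction_on with
  | zero => simp
  | tmul a a' => rw [insertHom_tmul, insertHom_tmul, ← mul_assoc, β.2.2 c hc, mul_assoc]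
  | add s t hs ht => simp only [map_add, AddMonoidHom.add_apply, hs, ht, add_mul]

/-- For `u ∈ (A ⊗_C A)^C` and `β ∈ S`, the element `u¹ β(u² -)` of `S`. -/
def insert (u : tensorSqCentralizer C) (β : S C) : S C :=
  ⟨insertHom β (u : TensorSq C), fun c hc x => by
    have h := u.2 c hc
    change insertHom β (u : TensorSq C) (c * x) = c * insertHom β (u : TensorSq C) x
    rw [← insertHom_rmul, ← h, insertHom_lmul],
   fun c hc x => insertHom_mul_right β c hc _ x⟩

variable (C) in
/-- Right D2 quasibases of `A ⊇ C`: elements `γ k ∈ S` and `u k ∈ (A ⊗_C A)^C` with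
`x ⊗ y = ∑ k, x γ_k(y) u_k` for all `x`, `y` in `A`. -/
structure RightD2Quasibases where
  N : ℕ
  γ : Fin N → S C
  u : Fin N → tensorSqCentralizer C
  eq : ∀ x y : A, NCTensor.tmul (↥C) x y =
    ∑ k, TensorSq.lmul C (x * (γ k : AddMonoid.End A) y) (u k : TensorSq C)

theorem IsRightD2.nonempty_quasibases (h : IsRightD2 C) : Nonempty (RightD2Quasibases C) := by
  obtain ⟨N, σ, π, h1, h2, h3, h4, h5⟩ := h
  refine ⟨⟨N, fun k => ⟨(Pi.evalAddMonoidHom (fun _ => A) k).comp (σ.comp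
      (AddMonoidHom.mk' (fun y => NCTensor.tmul (↥C) (1 : A) y)
        (fun y y' => NCTensor.tmul_add (↥C) 1 y y'))), ?_, ?_⟩,
    fun k => ⟨π (Pi.single k 1), fun c hc => ?_⟩, fun x y => ?_⟩⟩
  · intro c hc y
    change σ (NCTensor.tmul (↥C) 1 (c * y)) k = c * σ (NCTensor.tmul (↥C) 1 y) k
    rw [← h1 c (Subring.mem_top c), TensorSq.lmul_tmul, mul_one,
      show c * y = (⟨c, hc⟩ : C) • y from rfl, ← NCTensor.smul_tmul, op_smul_eq, one_mul]
  · intro c hc y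
    change σ (NCTensor.tmul (↥C) 1 (y * c)) k = σ (NCTensor.tmul (↥C) 1 y) k * c
    rw [← h2 c hc, TensorSq.rmul_tmul]
  · rw [← h3 c (Subring.mem_top c), ← h4 c hc]
    congr 1
    ext i
    by_cases hik : i = k
    · subst hik; simp
    · simp [hik]
  · change _ = ∑ k, TensorSq.lmul C (x * σ (NCTensor.tmul (↥C) 1 y) k) (π (Pi.single k 1))
    conv_lhs => rw [← h5 (NCTensor.tmul (↥C) x y)]
    simp_rw [← h3 _ (Subring.mem_top _)]
    rw [← map_sum]
    congr 1
    ext i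
    rw [Finset.sum_apply, Finset.sum_eq_single i]
    · rw [Pi.single_eq_same, mul_one, ← h1 x (Subring.mem_top x), TensorSq.lmul_tmul, mul_one]
    · intro k _ hk
      rw [Pi.single_eq_of_ne (Ne.symm hk), mul_zero]
    · simp

/-- The comultiplication `Δ(β) = ∑ k, γ_k ⊗_V u_k¹ β(u_k² -)` written with given right D2
quasibases. -/
def RightD2Quasibases.comul (q : RightD2Quasibases C) (β : S C) : STensorS C :=
  ∑ k, NCTensor.tmul (V C) (q.γ k) (insert (q.u k) β)

/-- The comultiplication `Δ : S → S ⊗_V S` of the left `V`-bialgebroid `S = End(_C A_C)` of a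
depth two extension `A ⊇ C`. It does not depend on the quasibases: see `comul_eq_iff`. -/
noncomputable def comul (h : IsD2 C) (β : S C) : STensorS C :=
  (Classical.choice h.right.nonempty_quasibases).comul β

/-- Evaluation `S ⊗_V S → A`, `α ⊗ β ↦ α(x) β(y)`. -/
def evalTensor (x y : A) : STensorS C →+ A :=
  NCTensor.lift
    (AddMonoidHom.mk'
      (fun α => AddMonoidHom.mk'
        (fun β => (α : AddMonoid.End A) x * (β : AddMonoid.End A) y)
        (fun _ _ => mul_add _ _ _))
      (fun _ _ => by ext β; exact add_mul _ _ _))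
    (fun α v β => mul_assoc ((α : AddMonoid.End A) x) (v : A) ((β : AddMonoid.End A) y))

theorem evalTensor_tmul (x y : A) (α β : S C) :
    evalTensor x y (NCTensor.tmul (V C) α β) =
      (α : AddMonoid.End A) x * (β : AddMonoid.End A) y := rfl

theorem RightD2Quasibases.evalTensor_comul (q : RightD2Quasibases C) (β : S C) (x y : A) :
    evalTensor x y (q.comul β) = (β : AddMonoid.End A) (x * y) := by
  have key := congrArg (fun t => insertHom β t y) (q.eq 1 x)
  simp only [insertHom_tmul, one_mul, map_sum, AddMonoidHom.finsetSum_apply,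
    insertHom_lmul] at key
  rw [RightD2Quasibases.comul, map_sum, key]
  rfl

theorem evalTensor_mul_left (c : A) (hc : c ∈ C) (x y : A) (t : STensorS C) :
    evalTensor (c * x) y t = c * evalTensor x y t := by
  induction t using NCTensor.induction_on with
  | zero => simp
  | tmul α β => rw [evalTensor_tmul, evalTensor_tmul, α.2.1 c hc, mul_assoc]
  | add s t hs ht => simp only [map_add, hs, ht, mul_add]

/-- For `t = ∑ α ⊗ β` in `S ⊗_V S` and `u ∈ A ⊗_C A`, the element `∑ u¹ α(u²) β(y)` of `A`. -/
def contract (t : STensorS C) (y : A) : TensorSq C →+ A :=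
  NCTensor.lift
    (AddMonoidHom.mk'
      (fun a => AddMonoidHom.mk' (fun a' => a * evalTensor a' y t)
        (fun a' a'' => by
          have h : evalTensor (a' + a'') y t = evalTensor a' y t + evalTensor a'' y t := by
            induction t using NCTensor.induction_on with
            | zero => simp
            | tmul α β => simp only [evalTensor_tmul, map_add, add_mul]
            | add s t hs ht => simp only [map_add, hs, ht]; abel
          rw [h, mul_add]))
      (fun a b => by ext a'; exact add_mul a b _))
    (fun a c a' => by
      change a * (c : A) * evalTensor a' y t = a * evalTensor ((c : A) * a') y t
      rw [evalTensor_mul_left (c : A) c.2, mul_assoc])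

theorem contract_congr {t t' : STensorS C} (h : ∀ x y, evalTensor x y t = evalTensor x y t')
    (y : A) (u : TensorSq C) : contract t y u = contract t' y u := by
  induction u using NCTensor.induction_on with
  | zero => simp
  | tmul a a' => exact congrArg (a * ·) (h a' y)
  | add u u' hu hu' => simp only [map_add, hu, hu']

theorem contract_tmul (α β : S C) (y : A) (u : TensorSq C) :
    contract (NCTensor.tmul (V C) α β) y u = insertHom α u 1 * (β : AddMonoid.End A) y := by
  induction u using NCTensor.induction_on with
  | zero => simp
  | tmul a a' =>
    rw [insertHom_tmul, mul_one, mul_assoc]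
    rfl
  | add u u' hu hu' => simp only [map_add, AddMonoidHom.add_apply, hu, hu', add_mul]

theorem contract_zero (y : A) (u : TensorSq C) : contract (0 : STensorS C) y u = 0 := by
  induction u using NCTensor.induction_on with
  | zero => simp
  | tmul a a' =>
    change a * evalTensor a' y (0 : STensorS C) = 0
    rw [map_zero, mul_zero]
  | add u u' hu hu' => rw [map_add, hu, hu', add_zero]

theorem contract_add (s t : STensorS C) (y : A) (u : TensorSq C) :
    contract (s + t) y u = contract s y u + contract t y u := by
  induction u using NCTensor.induction_on with
  | zero => simp
  | tmul a a' =>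
    change a * evalTensor a' y (s + t) = a * evalTensor a' y s + a * evalTensor a' y t
    rw [map_add, mul_add]
  | add u u' hu hu' => rw [map_add, hu, hu', map_add, map_add]; abel

/-- The counit `ε : S → V`, `ε(α) = α(1)`. -/
def counit (α : S C) : V C :=
  ⟨(α : AddMonoid.End A) 1, by
    rw [Subring.mem_centralizer_iff]
    intro c hc
    rw [← α.2.1 c hc, ← α.2.2 c hc, mul_one, one_mul]⟩

theorem RightD2Quasibases.exists_expansion (q : RightD2Quasibases C) (t : STensorS C) :
    ∃ H : Fin q.N → S C,
      (∀ k y, (H k : AddMonoid.End A) y = contract t y (q.u k : TensorSq C)) ∧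
        t = ∑ k, NCTensor.tmul (V C) (q.γ k) (H k) := by
  induction t using NCTensor.induction_on with
  | zero =>
    refine ⟨fun _ => 0, fun k y => (contract_zero y _).symm, ?_⟩
    refine (Finset.sum_eq_zero fun k _ => ?_).symm
    have h := NCTensor.tmul_add (V C) (q.γ k) (0 : S C) 0
    rw [add_zero] at h
    exact left_eq_add.1 h
  | tmul α β =>
    refine ⟨fun k => counit (insert (q.u k) α) • β, fun k y => (contract_tmul α β y _).symm, ?_⟩
    simp_rw [← NCTensor.smul_tmul]
    have hα : α = ∑ k, op (counit (insert (q.u k) α)) • q.γ k := by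
      ext x
      have key := congrArg (fun t => insertHom α t 1) (q.eq 1 x)
      simp only [insertHom_tmul, one_mul, mul_one, map_sum, AddMonoidHom.finsetSum_apply,
        insertHom_lmul] at key
      have hs := map_sum (AddMonoidHom.mk' (fun a : S C => (a : AddMonoid.End A) x)
        (fun _ _ => rfl) : S C →+ A)
        (fun k => op (counit (insert (q.u k) α)) • q.γ k) Finset.univ
      exact key.trans hs.symm
    have hsum : ∀ f : Fin q.N → S C,
        NCTensor.tmul (V C) (∑ k, f k) β = ∑ k, NCTensor.tmul (V C) (f k) β := fun f =>
      map_sum (AddMonoidHom.mk' (fun a : S C => NCTensor.tmul (V C) a β)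
        (fun a b => NCTensor.add_tmul (V C) a b β) : S C →+ STensorS C) f Finset.univ
    rw [← hsum, ← hα]
  | add s t hs ht =>
    obtain ⟨H, h1, h2⟩ := hs
    obtain ⟨K, k1, k2⟩ := ht
    refine ⟨fun k => H k + K k, fun k y => ?_, ?_⟩
    · rw [contract_add, ← h1, ← k1]
      rfl
    · simp_rw [NCTensor.tmul_add]
      rw [Finset.sum_add_distrib, ← h2, ← k2]

theorem RightD2Quasibases.ext_evalTensor (q : RightD2Quasibases C) {t t' : STensorS C}
    (h : ∀ x y, evalTensor x y t = evalTensor x y t') : t = t' := by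
  obtain ⟨H, h1, h2⟩ := q.exists_expansion t
  obtain ⟨K, k1, k2⟩ := q.exists_expansion t'
  rw [h2, k2]
  refine Finset.sum_congr rfl fun k _ => ?_
  congr 1
  ext y
  rw [h1, k1, contract_congr h]

/-- `Δ(β)` is the unique element `t = ∑ α ⊗ α'` of `S ⊗_V S` with `∑ α(x) α'(y) = β(x y)`. -/
theorem comul_eq_iff (h : IsD2 C) (β : S C) (t : STensorS C) :
    comul h β = t ↔ ∀ x y, evalTensor x y t = (β : AddMonoid.End A) (x * y) := by
  constructor
  · rintro rfl x y
    exact RightD2Quasibases.evalTensor_comul _ β x y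
  · intro ht
    refine (Classical.choice h.right.nonempty_quasibases).ext_evalTensor fun x y => ?_
    rw [ht]
    exact RightD2Quasibases.evalTensor_comul _ β x y

/-! ### Galois left coideal subrings and invariants -/

/-- A subring `J` of `S` that contains the image of `V` under the source map, as a left
`V`-submodule of `S`. -/
def toVSubmodule (J : Subring (S C)) (hJ : ∀ v : V C, source C v ∈ J) :
    Submodule (V C) (S C) where
  carrier := J
  add_mem' := J.add_mem
  zero_mem' := J.zero_mem
  smul_mem' v _ hα := J.mul_mem (hJ v) hα

/-- A left coideal subring `J` of `S`: a subring that is a left `V`-submodule, equivalently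
contains the image of `V` under the source map, with `Δ(J) ⊆ S ⊗_V J`, the latter being the image
in `S ⊗_V S` of the map induced by `J ⊆ S`. -/
structure IsLeftCoidealSubring (h : IsD2 C) (J : Subring (S C)) : Prop where
  source_mem : ∀ v : V C, source C v ∈ J
  comul_mem : ∀ α ∈ J, comul h α ∈
    (NCTensor.map (V C) (LinearMap.id : S C →ₗ[(V C)ᵐᵒᵖ] S C)
      (toVSubmodule J source_mem).subtype).range

/-- `J` is a Galois left coideal subring: it is a left coideal subring, it is finitely generated
projective as a left `V`-module, and every left ideal of `A` stable under `J` is `0` or `A`. -/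
structure IsGaloisLeftCoidealSubring (h : IsD2 C) (J : Subring (S C)) : Prop
    extends IsLeftCoidealSubring h J where
  finite : Module.Finite (V C) (toVSubmodule J source_mem)
  projective : Module.Projective (V C) (toVSubmodule J source_mem)
  simple : ∀ I : Ideal A,
    (∀ α ∈ J, ∀ x ∈ I, (α : AddMonoid.End A) x ∈ I) → I = ⊥ ∨ I = ⊤

/-- The invariants `A^J = {x ∈ A | α(x) = α(1) x for all α ∈ J}`. -/
def invariants (J : Subring (S C)) : Set A :=
  {x | ∀ α ∈ J, (α : AddMonoid.End A) x = (α : AddMonoid.End A) 1 * x}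

/-- `B` is a left D3 intermediate division ring of `A ⊇ C`. -/
structure IsLeftD3IntermediateDivisionRing (C B : Subring A) : Prop where
  le : C ≤ B
  division : IsDivisionSubring B
  leftD3 : IsLeftD3 C B

end DepthThree

/-! The argument is a Jacobson–Bourbaki correspondence. An intermediate ring `B` is encoded by
`End(A_B)`, and a coideal subring `J` by the ring `A J` of sums of maps `a α(-)`; the Galois
conditions ensure that `A J = End(A_B)` for `B = A^J`.

From `B` to `J`: left D3 quasibases `β i`, `t i` give `f = ∑ i, f(t i¹) t i² · β i` for every `f` in
`End(A_B)` (`LeftD3Quasibases.expand`). If `f` is also left `C`-linear, the coefficients lie in `V`,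
so this is a finite dual basis of `End(_C A_B)` over `V`. Since `B` is a division ring, `End(A_B)`
contains maps sending a given nonzero `x` to `1`, and maps killing `1` but not a given `x` outside
`B`. Expanding the former in the `β i` shows that there are no proper nonzero stable left ideals;
expanding the latter shows that the invariants are exactly `B`.

From `J` to `B`: the coideal condition makes `A J` a ring, and the absence of stable left ideals
makes `A` a simple `A J`-module. Its endomorphisms are the right multiplications by `B = A^J`, so
`B` is a division ring by Schur's lemma and `A J` is dense in `End(A_B)`. As `J` is finitely
generated over `V`, a map from `A` to a division ring bounds the rank of `A` over `B`
(`card_le_of_mul_eq_one`), and density becomes the equality `A J = End(A_B)`. Depth two and flatness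
make `A ⊗_V J → End(A_C)` injective. Hence `A ⊗_V J` and `A ⊗_V End(_C A_B)` have the same image,
and faithful flatness yields `J = End(_C A_B)`. Finally a dual basis of `J` over `V` is transported
through `A ⊗_V J ≅ End(A_B)` to left D3 quasibases of `B`. -/

namespace DepthThree

/-! ### Linear algebra over a division subring -/

section DivisionSubring

variable {A : Type u} [Ring A] {B : Subring A}

theorem IsDivisionSubring.isUnit_or_eq_zero (hB : IsDivisionSubring B) (b : (↥B)ᵐᵒᵖ) :
    IsUnit b ∨ b = 0 := by
  by_cases h : b = 0
  · exact Or.inr h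
  · have h0 : ((unop b : B) : A) ≠ 0 := fun h' =>
      h (unop_injective (Subtype.ext (by simpa using h')))
    obtain ⟨y, hy, h1, h2⟩ := hB.2 _ (unop b).2 h0
    exact Or.inl ⟨⟨b, op ⟨y, hy⟩, unop_injective (Subtype.ext h2),
      unop_injective (Subtype.ext h1)⟩, rfl⟩

theorem IsDivisionSubring.nontrivial (hB : IsDivisionSubring B) : Nontrivial (↥B)ᵐᵒᵖ :=
  ⟨1, 0, fun h => hB.1 (congrArg (fun b : (↥B)ᵐᵒᵖ => ((unop b : B) : A)) h)⟩

/-- The opposite of a division subring as a division ring. -/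
noncomputable abbrev IsDivisionSubring.divisionRing (hB : IsDivisionSubring B) :
    DivisionRing (↥B)ᵐᵒᵖ :=
  haveI := hB.nontrivial
  DivisionRing.ofIsUnitOrEqZero hB.isUnit_or_eq_zero

/-- The embedding of `B` into `A` as right `B`-modules. -/
def subringEmbedding (B : Subring A) : (↥B)ᵐᵒᵖ →ₗ[(↥B)ᵐᵒᵖ] A where
  toFun b := ((unop b : B) : A)
  map_add' _ _ := rfl
  map_smul' _ _ := rfl

theorem IsDivisionSubring.exists_linearMap_of_linearIndependent (hB : IsDivisionSubring B)
    {ι : Type*} {x : ι → A} (hx : LinearIndependent (↥B)ᵐᵒᵖ x) (y : ι → A) :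
    ∃ f : A →ₗ[(↥B)ᵐᵒᵖ] A, ∀ i, f (x i) = y i := by
  let := hB.divisionRing
  obtain ⟨g, hg⟩ := LinearMap.exists_extend ((Module.Basis.span hx).constr ℕ y)
  refine ⟨g, fun i => ?_⟩
  have h := LinearMap.congr_fun hg (Module.Basis.span hx i)
  rw [Module.Basis.constr_basis] at h
  rw [← h, LinearMap.comp_apply, Submodule.subtype_apply, Module.Basis.span_apply]

theorem IsDivisionSubring.exists_linearMap_apply_eq_one (hB : IsDivisionSubring B) {x : A}
    (hx : x ≠ 0) : ∃ f : A →ₗ[(↥B)ᵐᵒᵖ] A, f x = 1 := by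
  let := hB.divisionRing
  obtain ⟨f, hf⟩ := hB.exists_linearMap_of_linearIndependent
    (LinearIndependent.of_subsingleton (R := (↥B)ᵐᵒᵖ) (v := fun _ : Unit => x) () hx) (fun _ => 1)
  exact ⟨f, hf ()⟩

/-- A relation between `1` and `x` over `B` would put `x` in `1 · B = B`, so the two are independent
and their images can be prescribed. -/
theorem IsDivisionSubring.exists_linearMap_separating (hB : IsDivisionSubring B) {x : A}
    (hx : x ∉ B) : ∃ f : A →ₗ[(↥B)ᵐᵒᵖ] A, f 1 = 0 ∧ f x = 1 := by
  let := hB.divisionRing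
  have hli : LinearIndependent (↥B)ᵐᵒᵖ ![1, x] := by
    refine (LinearIndependent.pair_iff' hB.1).2 fun b hb => hx ?_
    rw [← hb]
    change 1 * ((unop b : B) : A) ∈ B
    rw [one_mul]
    exact (unop b).2
  obtain ⟨f, hf⟩ := hB.exists_linearMap_of_linearIndependent hli ![0, 1]
  exact ⟨f, hf 0, hf 1⟩

end DivisionSubring

/-! ### The pairing of `End(A_B)` and `A ⊗_B A`, and left D3 quasibases -/

section Quasibases

variable {A : Type u} [Ring A] {C B : Subring A}

theorem map_mul_coe (f : A →ₗ[(↥B)ᵐᵒᵖ] A) (x : A) (b : B) : f (x * b) = f x * b :=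
  f.map_smul (op b) x

/-- For `f ∈ End(A_B)` and `t ∈ A ⊗_B A`, the element `f(t¹) t²` of `A`. -/
def pairing (f : A →ₗ[(↥B)ᵐᵒᵖ] A) : TensorSq B →+ A :=
  NCTensor.lift (AddMonoidHom.mul.comp f.toAddMonoidHom) (fun x b y => by
    change f (x * b) * y = f x * (b * y)
    rw [map_mul_coe, mul_assoc])

@[simp]
theorem pairing_tmul (f : A →ₗ[(↥B)ᵐᵒᵖ] A) (x y : A) :
    pairing f (NCTensor.tmul (↥B) x y) = f x * y := rfl

theorem pairing_rmul (f : A →ₗ[(↥B)ᵐᵒᵖ] A) (a : A) (t : TensorSq B) :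
    pairing f (TensorSq.rmul B a t) = pairing f t * a := by
  induction t using NCTensor.induction_on with
  | zero => simp
  | tmul x y => rw [TensorSq.rmul_tmul, pairing_tmul, pairing_tmul, mul_assoc]
  | add s t hs ht => simp only [map_add, hs, ht, add_mul]

/-- Two uses share this form: `g = f` and `a = c` when `f` is left `C`-linear, and `g = f(c -)` with
`a = 1` for general `f`. -/
theorem pairing_congr {f : A →ₗ[(↥B)ᵐᵒᵖ] A} {g : A →ₗ[(↥B)ᵐᵒᵖ] A} {a c : A}
    (h : ∀ x, f (c * x) = a * g x) (t : TensorSq B) :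
    pairing f (TensorSq.lmul B c t) = a * pairing g t := by
  induction t using NCTensor.induction_on with
  | zero => simp
  | tmul x y => rw [TensorSq.lmul_tmul, pairing_tmul, pairing_tmul, h, mul_assoc]
  | add s t hs ht => simp only [map_add, hs, ht, mul_add]

theorem pairing_mul_left {f g : A →ₗ[(↥B)ᵐᵒᵖ] A} {a : A} (h : ∀ x, f x = a * g x)
    (t : TensorSq B) : pairing f t = a * pairing g t := by
  induction t using NCTensor.induction_on with
  | zero => simp
  | tmul x y => rw [pairing_tmul, pairing_tmul, h, mul_assoc]
  | add s t hs ht => simp only [map_add, hs, ht, mul_add]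

theorem pairing_add (f g : A →ₗ[(↥B)ᵐᵒᵖ] A) (t : TensorSq B) :
    pairing (f + g) t = pairing f t + pairing g t := by
  induction t using NCTensor.induction_on with
  | zero => simp
  | tmul x y => simp [add_mul]
  | add s t hs ht => simp only [map_add, hs, ht]; abel

/-- A map that commutes with right multiplication by `B` as a linear map. -/
def bimodEndToLin {f : AddMonoid.End A} (hf : f ∈ bimodEnd C B) : A →ₗ[(↥B)ᵐᵒᵖ] A where
  toFun := f
  map_add' := f.map_add
  map_smul' b x := hf.2 (unop b : B) (unop b).2 x

variable (C B) in
/-- Left D3 quasibases of `A ⊇ B ⊇ C`: elements `β i ∈ End(_C A_B)` and `t i ∈ (A ⊗_B A)^C` with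
`x ⊗ y = ∑ i, t_i β_i(x) y` for all `x`, `y` in `A`. -/
structure LeftD3Quasibases where
  N : ℕ
  β : Fin N → AddMonoid.End A
  β_mem : ∀ i, β i ∈ bimodEnd C B
  t : Fin N → TensorSq B
  central : ∀ i, ∀ c ∈ C, TensorSq.lmul B c (t i) = TensorSq.rmul B c (t i)
  eq : ∀ x y : A, NCTensor.tmul (↥B) x y = ∑ i, TensorSq.rmul B (β i x * y) (t i)

theorem TensorSq.rmul_mul (a a' : A) (t : TensorSq B) :
    TensorSq.rmul B (a * a') t = TensorSq.rmul B a' (TensorSq.rmul B a t) := by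
  induction t using NCTensor.induction_on with
  | zero => simp
  | tmul x y => simp only [TensorSq.rmul_tmul, mul_assoc]
  | add s t hs ht => simp only [map_add, hs, ht]

theorem TensorSq.rmul_add (a a' : A) (t : TensorSq B) :
    TensorSq.rmul B (a + a') t = TensorSq.rmul B a t + TensorSq.rmul B a' t := by
  induction t using NCTensor.induction_on with
  | zero => simp
  | tmul x y => simp only [TensorSq.rmul_tmul, mul_add, NCTensor.tmul_add]
  | add s t hs ht => simp only [map_add, hs, ht]; abel

theorem TensorSq.lmul_rmul (a a' : A) (t : TensorSq B) :
    TensorSq.lmul B a (TensorSq.rmul B a' t) = TensorSq.rmul B a' (TensorSq.lmul B a t) := by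
  induction t using NCTensor.induction_on with
  | zero => simp
  | tmul x y => rfl
  | add s t hs ht => simp only [map_add, hs, ht]

theorem IsLeftD3.nonempty_quasibases (h : IsLeftD3 C B) : Nonempty (LeftD3Quasibases C B) := by
  obtain ⟨N, σ, π, h1, h2, h3, h4, h5⟩ := h
  refine ⟨⟨N, fun k => (Pi.evalAddMonoidHom (fun _ => A) k).comp (σ.comp
      (AddMonoidHom.mk' (fun x => NCTensor.tmul (↥B) x (1 : A))
        (fun x x' => NCTensor.add_tmul (↥B) x x' 1))), ?_,
    fun k => π (Pi.single k 1), fun k c hc => ?_, fun x y => ?_⟩⟩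
  · refine fun k => ⟨fun c hc x => ?_, fun b hb x => ?_⟩
    · change σ (NCTensor.tmul (↥B) (c * x) 1) k = c * σ (NCTensor.tmul (↥B) x 1) k
      rw [← h1 c hc, TensorSq.lmul_tmul]
    · change σ (NCTensor.tmul (↥B) (x * b) 1) k = σ (NCTensor.tmul (↥B) x 1) k * b
      rw [← h2 b (Subring.mem_top b), TensorSq.rmul_tmul, one_mul,
        show x * b = op (⟨b, hb⟩ : B) • x from rfl, NCTensor.smul_tmul]
      change σ (NCTensor.tmul (↥B) x (b * 1)) k = _
      rw [mul_one]
  · rw [← h3 c hc, ← h4 c (Subring.mem_top c)]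
    congr 1
    ext i
    by_cases hik : i = k
    · subst hik; simp
    · simp [hik]
  · change _ = ∑ k, TensorSq.rmul B (σ (NCTensor.tmul (↥B) x 1) k * y) (π (Pi.single k 1))
    conv_lhs => rw [← h5 (NCTensor.tmul (↥B) x y)]
    simp_rw [← h4 _ (Subring.mem_top _)]
    rw [← map_sum]
    congr 1
    ext i
    rw [Finset.sum_apply, Finset.sum_eq_single i]
    · rw [Pi.single_eq_same, one_mul, ← h2 y (Subring.mem_top y), TensorSq.rmul_tmul, one_mul]
    · intro k _ hk
      rw [Pi.single_eq_of_ne (Ne.symm hk), zero_mul]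
    · simp

namespace LeftD3Quasibases

variable (q : LeftD3Quasibases C B)

theorem isLeftD3 (q : LeftD3Quasibases C B) : IsLeftD3 C B := by
  let σ : TensorSq B →+ (Fin q.N → A) :=
    AddMonoidHom.mk' (fun t i => pairing (bimodEndToLin (q.β_mem i)) t)
      (fun s t => funext fun i => map_add _ s t)
  let π : (Fin q.N → A) →+ TensorSq B :=
    AddMonoidHom.mk' (fun f => ∑ i, TensorSq.rmul B (f i) (q.t i)) (fun f g => by
      simp only [Pi.add_apply, TensorSq.rmul_add, Finset.sum_add_distrib])
  refine ⟨q.N, σ, π, fun c hc t i => ?_, fun a _ t i => pairing_rmul _ a t, fun c hc f => ?_,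
    fun a _ f => ?_, fun t => ?_⟩
  · exact pairing_congr (fun x => (q.β_mem i).1 c hc x) t
  · change ∑ i, TensorSq.rmul B (c * f i) (q.t i) =
      TensorSq.lmul B c (∑ i, TensorSq.rmul B (f i) (q.t i))
    rw [map_sum]
    exact Finset.sum_congr rfl fun i _ => by
      rw [TensorSq.rmul_mul, TensorSq.lmul_rmul, q.central i c hc]
  · change ∑ i, TensorSq.rmul B (f i * a) (q.t i) =
      TensorSq.rmul B a (∑ i, TensorSq.rmul B (f i) (q.t i))
    rw [map_sum]
    exact Finset.sum_congr rfl fun i _ => TensorSq.rmul_mul _ _ _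
  · induction t using NCTensor.induction_on with
    | zero => rw [map_zero, map_zero]
    | tmul x y => exact (q.eq x y).symm
    | add s t hs ht => rw [map_add, map_add, hs, ht]

/-- Pairing `f` with the quasibase identity for `x ⊗ 1` gives this. No `C`-linearity of `f` is
needed, so the `β i` span all of `End(A_B)` over `A`. -/
theorem expand (f : A →ₗ[(↥B)ᵐᵒᵖ] A) (x : A) :
    f x = ∑ i, pairing f (q.t i) * q.β i x := by
  have h := congrArg (pairing f) (q.eq x 1)
  simpa only [pairing_tmul, mul_one, map_sum, pairing_rmul] using h

/-- Left `C`-linearity of `f` lets `c` enter on the left of `t i`; centrality of `t i` lets it leave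
on the right. -/
theorem pairing_mem_V {f : AddMonoid.End A} (hf : f ∈ bimodEnd C B) (i : Fin q.N) :
    pairing (bimodEndToLin hf) (q.t i) ∈ V C := by
  rw [Subring.mem_centralizer_iff]
  intro c hc
  rw [← pairing_congr (f := bimodEndToLin hf) (fun x => hf.1 c hc x), q.central i c hc,
    pairing_rmul]

end LeftD3Quasibases

end Quasibases

/-! ### From left D3 intermediate division rings to Galois left coideal subrings -/

section EndomorphismSubring

variable {A : Type u} [Ring A] {C B : Subring A}

variable (C B) in
/-- `End(_C A_B)` as a subring of `S`. -/
def endSubring : Subring (S C) := (bimodEnd C B).comap (S C).subtype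

theorem mem_endSubring {α : S C} :
    α ∈ endSubring C B ↔ (α : AddMonoid.End A) ∈ bimodEnd C B := Iff.rfl

theorem apply_mul_of_mem_endSubring {α : S C} (hα : α ∈ endSubring C B) {b : A} (hb : b ∈ B)
    (x : A) : (α : AddMonoid.End A) (x * b) = (α : AddMonoid.End A) x * b := hα.2 b hb x

theorem endSubring_map (h : C ≤ B) : (endSubring C B).map (S C).subtype = bimodEnd C B := by
  ext f
  constructor
  · rintro ⟨α, hα, rfl⟩
    exact hα
  · exact fun hf => ⟨⟨f, hf.1, fun c hc => hf.2 c (h hc)⟩, hf, rfl⟩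

theorem source_mem_endSubring (v : V C) : source C v ∈ endSubring C B :=
  ⟨(source C v).2.1, fun b _ x => (mul_assoc (v : A) x b).symm⟩

theorem insert_mem_endSubring (u : tensorSqCentralizer C) {β : S C} (hβ : β ∈ endSubring C B) :
    insert u β ∈ endSubring C B := by
  refine ⟨(insert u β).2.1, fun b hb x => ?_⟩
  change insertHom β (u : TensorSq C) (x * b) = insertHom β (u : TensorSq C) x * b
  induction (u : TensorSq C) using NCTensor.induction_on with
  | zero => simp
  | tmul a a' => rw [insertHom_tmul, insertHom_tmul, ← mul_assoc,
    apply_mul_of_mem_endSubring hβ hb, mul_assoc]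
  | add s t hs ht => simp only [map_add, AddMonoidHom.add_apply, hs, ht, add_mul]

theorem isLeftCoidealSubring_endSubring (h : IsD2 C) :
    IsLeftCoidealSubring h (endSubring C B) where
  source_mem := source_mem_endSubring
  comul_mem α hα := by
    rw [comul, RightD2Quasibases.comul]
    refine AddSubgroup.sum_mem _ fun k _ => ?_
    exact ⟨NCTensor.tmul (V C) _ ⟨_, insert_mem_endSubring _ hα⟩, rfl⟩

namespace LeftD3Quasibases

variable (q : LeftD3Quasibases C B)

/-- The left D3 quasibases as elements of `End(_C A_B)`. -/
def basisElement (h : C ≤ B) (i : Fin q.N) : toVSubmodule (endSubring C B) source_mem_endSubring :=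
  ⟨⟨q.β i, (q.β_mem i).1, fun c hc => (q.β_mem i).2 c (h hc)⟩, q.β_mem i⟩

/-- The coordinates of an element of `End(_C A_B)` in left D3 quasibases. -/
def coordinates :
    toVSubmodule (endSubring C B) source_mem_endSubring →ₗ[V C] (Fin q.N → V C) where
  toFun α i := ⟨pairing (bimodEndToLin α.2) (q.t i), q.pairing_mem_V α.2 i⟩
  map_add' α β := funext fun i => Subtype.ext
    (pairing_add (bimodEndToLin α.2) (bimodEndToLin β.2) (q.t i))
  map_smul' v α := funext fun i => Subtype.ext
    (pairing_mul_left (f := bimodEndToLin (v • α).2) (g := bimodEndToLin α.2) (a := (v : A))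
      (fun x => smul_apply C v (α : S C) x) (q.t i))

theorem sum_coordinates (h : C ≤ B)
    (α : toVSubmodule (endSubring C B) source_mem_endSubring) :
    ∑ i, q.coordinates α i • q.basisElement h i = α := by
  ext x
  have hs := map_sum (AddMonoidHom.mk'
    (fun a : toVSubmodule (endSubring C B) source_mem_endSubring =>
      ((a : S C) : AddMonoid.End A) x) (fun _ _ => rfl))
    (fun i => q.coordinates α i • q.basisElement h i) Finset.univ
  exact hs.trans (q.expand (bimodEndToLin α.2) x).symm

theorem finite_endSubring (q : LeftD3Quasibases C B) (h : C ≤ B) :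
    Module.Finite (V C) (toVSubmodule (endSubring C B) source_mem_endSubring) :=
  Module.Finite.of_surjective (Fintype.linearCombination (V C) (q.basisElement h))
    fun α => ⟨q.coordinates α, q.sum_coordinates h α⟩

theorem projective_endSubring (q : LeftD3Quasibases C B) (h : C ≤ B) :
    Module.Projective (V C) (toVSubmodule (endSubring C B) source_mem_endSubring) :=
  Module.Projective.of_split q.coordinates
    (Fintype.linearCombination (V C) (q.basisElement h))
    (LinearMap.ext fun α => q.sum_coordinates h α)

end LeftD3Quasibases

theorem IsLeftD3IntermediateDivisionRing.isGalois (h : IsD2 C)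
    (hB : IsLeftD3IntermediateDivisionRing C B) :
    IsGaloisLeftCoidealSubring h (endSubring C B) := by
  obtain ⟨q⟩ := hB.leftD3.nonempty_quasibases
  refine ⟨isLeftCoidealSubring_endSubring h, q.finite_endSubring hB.le,
    q.projective_endSubring hB.le, fun I hI => ?_⟩
  refine or_iff_not_imp_left.2 fun hne => ?_
  obtain ⟨x, hx, hx0⟩ := Submodule.exists_mem_ne_zero_of_ne_bot hne
  obtain ⟨f, hfx⟩ := hB.division.exists_linearMap_apply_eq_one hx0
  -- Here `1 = f x` is a left `A`-combination of the `β i x`, all of which lie in the stable ideal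
  -- `I`.
  rw [Ideal.eq_top_iff_one, ← hfx, q.expand f x]
  refine sum_mem fun i _ => I.mul_mem_left _ ?_
  exact hI ⟨q.β i, (q.β_mem i).1, fun c hc => (q.β_mem i).2 c (hB.le hc)⟩ (q.β_mem i) x hx

theorem IsLeftD3IntermediateDivisionRing.invariants_endSubring
    (hB : IsLeftD3IntermediateDivisionRing C B) : invariants (endSubring C B) = (B : Set A) := by
  obtain ⟨q⟩ := hB.leftD3.nonempty_quasibases
  ext x
  constructor
  · intro hx
    by_contra hxB
    obtain ⟨f, h1, hfx⟩ := hB.division.exists_linearMap_separating hxB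
    apply hB.division.1
    -- Invariance of `x` under every `β i` passes to `f` by the expansion, so `1 = f x = f 1 * x =
    -- 0`.
    rw [← hfx, ← zero_mul x, ← h1, q.expand f x, q.expand f 1, Finset.sum_mul]
    refine Finset.sum_congr rfl fun i _ => ?_
    rw [mul_assoc]
    exact congrArg _
      (hx ⟨q.β i, (q.β_mem i).1, fun c hc => (q.β_mem i).2 c (hB.le hc)⟩ (q.β_mem i))
  · intro hx α hα
    rw [← apply_mul_of_mem_endSubring hα hx, one_mul]

end EndomorphismSubring

/-! ### The action map `A ⊗_V S → End(A_C)` -/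

section Action

variable {A : Type u} [Ring A] {C B : Subring A}

/-- The map `x ↦ a f(x)`. -/
def mulLin (a : A) (f : A →ₗ[(↥B)ᵐᵒᵖ] A) : A →ₗ[(↥B)ᵐᵒᵖ] A where
  toFun x := a * f x
  map_add' x y := by rw [map_add, mul_add]
  map_smul' b x := by
    rw [map_smul]
    exact (mul_assoc a (f x) _).symm

variable (C) in
/-- The action map `A ⊗_V S → End(A_C)`, `a ⊗ α ↦ a α(-)`. -/
def action : NCTensor (V C) A (S C) →+ (A →ₗ[(↥C)ᵐᵒᵖ] A) :=
  NCTensor.lift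
    (AddMonoidHom.mk'
      (fun a => AddMonoidHom.mk' (fun α => mulLin a (bimodEndToLin α.2))
        (fun α β => LinearMap.ext fun x =>
          mul_add a ((α : AddMonoid.End A) x) ((β : AddMonoid.End A) x)))
      (fun a b => by
        ext α x
        exact add_mul a b ((α : AddMonoid.End A) x)))
    (fun a v α => LinearMap.ext fun x => mul_assoc a (v : A) ((α : AddMonoid.End A) x))

theorem NCTensor.tmul_sum {R M N ι : Type*} [Ring R] [AddCommGroup M] [Module Rᵐᵒᵖ M]
    [AddCommGroup N] [Module R N] (s : Finset ι) (m : M) (n : ι → N) :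
    NCTensor.tmul R m (∑ i ∈ s, n i) = ∑ i ∈ s, NCTensor.tmul R m (n i) :=
  map_sum (AddMonoidHom.mk' (NCTensor.tmul R m) (NCTensor.tmul_add R m)) n s

theorem NCTensor.zero_tmul {R M N : Type*} [Ring R] [AddCommGroup M] [Module Rᵐᵒᵖ M]
    [AddCommGroup N] [Module R N] (n : N) : NCTensor.tmul R (0 : M) n = 0 :=
  map_zero (AddMonoidHom.mk' (fun m : M => NCTensor.tmul R m n)
    fun m m' => NCTensor.add_tmul R m m' n)

theorem pairing_zero (t : TensorSq B) : pairing (0 : A →ₗ[(↥B)ᵐᵒᵖ] A) t = 0 := by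
  rw [pairing_mul_left (f := 0) (g := 0) (a := 0) (fun x => by simp), zero_mul]

/-- A tensor is recovered from the map by which it acts. For `a ⊗ α` the coefficients of `α` in the
`β i` lie in `V` and can be moved across the tensor sign. -/
theorem LeftD3Quasibases.tensor_expand (q : LeftD3Quasibases C C)
    (t : NCTensor (V C) A (S C)) :
    t = ∑ i, NCTensor.tmul (V C) (pairing (action C t) (q.t i))
      (⟨q.β i, q.β_mem i⟩ : S C) := by
  induction t using NCTensor.induction_on with
  | zero => simp only [map_zero, pairing_zero, NCTensor.zero_tmul, Finset.sum_const_zero]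
  | tmul a α =>
    have h : ∀ i, pairing (action C (NCTensor.tmul (V C) a α)) (q.t i) =
        (op (⟨_, q.pairing_mem_V α.2 i⟩ : V C)) • a := fun i =>
      pairing_mul_left (g := bimodEndToLin α.2) (fun _ => rfl) (q.t i)
    simp_rw [h, NCTensor.smul_tmul]
    rw [← NCTensor.tmul_sum]
    congr 1
    ext x
    refine (q.expand (bimodEndToLin α.2) x).trans ?_
    exact (map_sum (AddMonoidHom.mk' (fun a : S C => (a : AddMonoid.End A) x)
      (fun _ _ => rfl) : S C →+ A) (fun i => (⟨_, q.pairing_mem_V α.2 i⟩ : V C) •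
        (⟨q.β i, q.β_mem i⟩ : S C)) Finset.univ).symm
  | add s t hs ht =>
    simp only [map_add, pairing_add, NCTensor.add_tmul, Finset.sum_add_distrib, ← hs, ← ht]

theorem action_injective (h : IsLeftD2 C) : Function.Injective (action C) := by
  obtain ⟨q⟩ := IsLeftD3.nonempty_quasibases h
  intro s t hst
  rw [q.tensor_expand s, q.tensor_expand t, hst]

end Action

/-! ### Faithful flatness -/

section FaithfullyFlat

variable {R M : Type u} [Ring R] [AddCommGroup M] [Module Rᵐᵒᵖ M]

theorem NCTensor.map_zero_right {X Y : Type*} [AddCommGroup X] [Module R X] [AddCommGroup Y]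
    [Module R Y] (t : NCTensor R M X) :
    NCTensor.map R (LinearMap.id : M →ₗ[Rᵐᵒᵖ] M) (0 : X →ₗ[R] Y) t = 0 := by
  induction t using NCTensor.induction_on with
  | zero => rw [map_zero]
  | tmul m x =>
    exact map_zero (AddMonoidHom.mk' (NCTensor.tmul R m) (NCTensor.tmul_add R (N := Y) m))
  | add s t hs ht => rw [map_add, hs, ht, add_zero]

variable {X Y : Type u} [AddCommGroup X] [Module R X] [AddCommGroup Y] [Module R Y]

theorem RightFaithfullyFlat.map_injective (h : RightFaithfullyFlat R M) {f : X →ₗ[R] Y}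
    (hf : Function.Injective f) :
    Function.Injective (NCTensor.map R (LinearMap.id : M →ₗ[Rᵐᵒᵖ] M) f) := by
  -- Injectivity is exactness of `0 → X → Y`, which the tensor product preserves.
  have hex := (h PUnit.{u + 1} X Y 0 f).1 fun y => by
    rw [map_eq_zero_iff f hf]
    exact ⟨fun hy => ⟨0, by rw [hy, map_zero]⟩, fun ⟨_, hy⟩ => hy.symm⟩
  rw [injective_iff_map_eq_zero]
  intro t ht
  obtain ⟨s, rfl⟩ := (hex t).1 ht
  exact NCTensor.map_zero_right s

theorem RightFaithfullyFlat.surjective_of_map (h : RightFaithfullyFlat R M) {f : X →ₗ[R] Y}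
    (hf : Function.Surjective (NCTensor.map R (LinearMap.id : M →ₗ[Rᵐᵒᵖ] M) f)) :
    Function.Surjective f := by
  -- Surjectivity is exactness of `X → Y → 0`, which the tensor product reflects.
  have hex := (h X Y PUnit.{u + 1} f 0).2 fun t =>
    ⟨fun _ => hf t, fun _ => NCTensor.map_zero_right t⟩
  exact fun y => (hex y).1 rfl

end FaithfullyFlat

/-! ### The subring of `End(A_C)` generated by `A` and a left coideal subring -/

section SmashRing

variable {A : Type u} [Ring A] {C : Subring A} {J : Subring (S C)}
  (hJ : ∀ v : V C, source C v ∈ J)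

/-- The restriction of the action map to `A ⊗_V J`. -/
def coidealAction : NCTensor (V C) A (toVSubmodule J hJ) →+ (A →ₗ[(↥C)ᵐᵒᵖ] A) :=
  (action C).comp (NCTensor.map (V C) LinearMap.id (toVSubmodule J hJ).subtype)

theorem coidealAction_tmul (a : A) (α : toVSubmodule J hJ) (x : A) :
    coidealAction hJ (NCTensor.tmul (V C) a α) x = a * ((α : S C) : AddMonoid.End A) x := rfl

theorem coidealAction_injective (h : IsLeftD2 C) (hff : RightFaithfullyFlat (V C) A) :
    Function.Injective (coidealAction hJ) :=
  (action_injective h).comp (hff.map_injective (toVSubmodule J hJ).injective_subtype)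

/-- Left multiplication by `a` on `A ⊗_V J`. -/
def coidealLmul (a : A) :
    NCTensor (V C) A (toVSubmodule J hJ) →+ NCTensor (V C) A (toVSubmodule J hJ) :=
  NCTensor.map (V C)
    { toFun := fun x => a * x
      map_add' := mul_add a
      map_smul' := fun v x => (mul_assoc a x (v.unop : A)).symm } LinearMap.id

/-- Right multiplication by `c ∈ C` on the left factor of `A ⊗_V J`. -/
def coidealRmul (c : A) (hc : c ∈ C) :
    NCTensor (V C) A (toVSubmodule J hJ) →+ NCTensor (V C) A (toVSubmodule J hJ) :=
  NCTensor.map (V C)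
    { toFun := fun x => x * c
      map_add' := fun x y => add_mul x y c
      map_smul' := fun v x => by
        change x * (v.unop : A) * c = x * c * (v.unop : A)
        rw [mul_assoc, mul_assoc, Subring.mem_centralizer_iff.1 v.unop.2 c hc] } LinearMap.id

theorem coidealAction_lmul (a : A) (t : NCTensor (V C) A (toVSubmodule J hJ)) (x : A) :
    coidealAction hJ (coidealLmul hJ a t) x = a * coidealAction hJ t x := by
  induction t using NCTensor.induction_on with
  | zero => simp
  | tmul b α => exact mul_assoc a b _
  | add s t hs ht => simp only [map_add, LinearMap.add_apply, hs, ht, mul_add]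

theorem coidealAction_rmul (c : A) (hc : c ∈ C) (t : NCTensor (V C) A (toVSubmodule J hJ))
    (x : A) : coidealAction hJ (coidealRmul hJ c hc t) x = coidealAction hJ t (c * x) := by
  induction t using NCTensor.induction_on with
  | zero => simp
  | tmul b α =>
    rw [coidealAction_tmul, (α : S C).2.1 c hc, ← mul_assoc]
    rfl
  | add s t hs ht => simp only [map_add, LinearMap.add_apply, hs, ht]

theorem exists_coidealAction_comp (t : NCTensor (V C) A (toVSubmodule J hJ)) {β : S C}
    (hβ : β ∈ J) :
    ∃ s, ∀ x, coidealAction hJ s x = coidealAction hJ t ((β : AddMonoid.End A) x) := by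
  induction t using NCTensor.induction_on with
  | zero => exact ⟨0, fun x => by simp⟩
  | tmul a α =>
    exact ⟨NCTensor.tmul (V C) a ⟨(α : S C) * β, J.mul_mem α.2 hβ⟩, fun x => rfl⟩
  | add s t hs ht =>
    obtain ⟨s', hs⟩ := hs
    obtain ⟨t', ht⟩ := ht
    exact ⟨s' + t', fun x => by simp only [map_add, LinearMap.add_apply, hs, ht]⟩

theorem exists_evalTensor_eq_coidealAction (b : A)
    (t : NCTensor (V C) (S C) (toVSubmodule J hJ)) :
    ∃ s, ∀ x, coidealAction hJ s x = evalTensor b x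
      (NCTensor.map (V C) (LinearMap.id : S C →ₗ[(V C)ᵐᵒᵖ] S C)
        (toVSubmodule J hJ).subtype t) := by
  induction t using NCTensor.induction_on with
  | zero => exact ⟨0, fun x => by simp⟩
  | tmul σ α => exact ⟨NCTensor.tmul (V C) ((σ : AddMonoid.End A) b) α, fun x => rfl⟩
  | add s t hs ht =>
    obtain ⟨s', hs⟩ := hs
    obtain ⟨t', ht⟩ := ht
    exact ⟨s' + t', fun x => by simp only [map_add, LinearMap.add_apply, hs, ht]⟩

variable {hJ}

/-- This is what the coideal condition provides: `α(b x) = ∑ α₁(b) α₂(x)` with all `α₂` in `J`, so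
`α` composed with left multiplication by `b` again lies in `A J`. -/
theorem IsLeftCoidealSubring.exists_coidealAction {h : IsD2 C} (hc : IsLeftCoidealSubring h J)
    {α : S C} (hα : α ∈ J) (b : A) :
    ∃ s, ∀ x, coidealAction hc.source_mem s x = (α : AddMonoid.End A) (b * x) := by
  obtain ⟨t, ht⟩ := hc.comul_mem α hα
  obtain ⟨s, hs⟩ := exists_evalTensor_eq_coidealAction hc.source_mem b t
  exact ⟨s, fun x => by rw [hs, ht, (comul_eq_iff h α _).1 rfl b x]⟩

theorem IsLeftCoidealSubring.exists_coidealAction_mul {h : IsD2 C}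
    (hc : IsLeftCoidealSubring h J) (s t : NCTensor (V C) A (toVSubmodule J hc.source_mem)) :
    ∃ r, ∀ x, coidealAction hc.source_mem r x =
      coidealAction hc.source_mem s (coidealAction hc.source_mem t x) := by
  induction s using NCTensor.induction_on with
  | zero => exact ⟨0, fun x => by simp⟩
  | add s s' hs hs' =>
    obtain ⟨r, hs⟩ := hs
    obtain ⟨r', hs'⟩ := hs'
    exact ⟨r + r', fun x => by simp only [map_add, LinearMap.add_apply, hs, hs']⟩
  | tmul a α =>
    induction t using NCTensor.induction_on with
    | zero => exact ⟨0, fun x => by simp⟩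
    | add t t' ht ht' =>
      obtain ⟨r, ht⟩ := ht
      obtain ⟨r', ht'⟩ := ht'
      exact ⟨r + r', fun x => by simp only [map_add, LinearMap.add_apply, ht, ht']⟩
    | tmul b β =>
      obtain ⟨r, hr⟩ := hc.exists_coidealAction α.2 b
      obtain ⟨r', hr'⟩ := exists_coidealAction_comp hc.source_mem r β.2
      exact ⟨coidealLmul _ a r', fun x => by
        rw [coidealAction_lmul, hr', hr, coidealAction_tmul, coidealAction_tmul]⟩

/-- The subring `A J` of `End(A_C)`, the image of `A ⊗_V J` under the action map. -/
def IsLeftCoidealSubring.smashRing {h : IsD2 C} (hc : IsLeftCoidealSubring h J) :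
    Subring (AddMonoid.End A) where
  carrier := {f | ∃ t, ∀ x, coidealAction hc.source_mem t x = f x}
  zero_mem' := ⟨0, fun x => by simp⟩
  one_mem' := ⟨NCTensor.tmul (V C) 1 ⟨1, J.one_mem⟩, fun x => one_mul x⟩
  add_mem' := fun {f g} ⟨s, hs⟩ ⟨t, ht⟩ => ⟨s + t, fun x => by
    rw [map_add, LinearMap.add_apply, hs, ht]
    rfl⟩
  neg_mem' := fun {f} ⟨s, hs⟩ => ⟨-s, fun x => by
    rw [map_neg, LinearMap.neg_apply, hs]
    rfl⟩
  mul_mem' := fun {f g} ⟨s, hs⟩ ⟨t, ht⟩ => by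
    obtain ⟨r, hr⟩ := hc.exists_coidealAction_mul s t
    exact ⟨r, fun x => by
      rw [hr, ht, hs]
      rfl⟩

theorem IsLeftCoidealSubring.mem_smashRing {h : IsD2 C} (hc : IsLeftCoidealSubring h J) {α : S C}
    (hα : α ∈ J) : (α : AddMonoid.End A) ∈ hc.smashRing :=
  ⟨NCTensor.tmul (V C) 1 ⟨α, hα⟩, fun x => one_mul ((α : AddMonoid.End A) x)⟩

theorem IsLeftCoidealSubring.mulLeft_mem_smashRing {h : IsD2 C} (hc : IsLeftCoidealSubring h J)
    (a : A) : AddMonoidHom.mulLeft a ∈ hc.smashRing :=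
  ⟨NCTensor.tmul (V C) a ⟨1, J.one_mem⟩, fun _ => rfl⟩

end SmashRing

/-! ### The invariant subring -/

section Invariants

variable {A : Type u} [Ring A] {C : Subring A}

/-- The subring of the `b ∈ A` such that all elements of `J` commute with right multiplication
by `b`. -/
def invariantSubring (J : Subring (S C)) : Subring A where
  carrier := {b | ∀ α ∈ J, ∀ x, (α : AddMonoid.End A) (x * b) = (α : AddMonoid.End A) x * b}
  zero_mem' := fun α _ x => by simp
  one_mem' := fun α _ x => by simp
  add_mem' := fun {a b} ha hb α hα x => by
    rw [mul_add, map_add, ha α hα, hb α hα, mul_add]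
  neg_mem' := fun {a} ha α hα x => by rw [mul_neg, map_neg, ha α hα, mul_neg]
  mul_mem' := fun {a b} ha hb α hα x => by
    rw [← mul_assoc, hb α hα, ha α hα, mul_assoc]

variable {J : Subring (S C)}

theorem le_invariantSubring : C ≤ invariantSubring J := fun c hc α _ x => α.2.2 c hc x

theorem le_endSubring_invariantSubring : J ≤ endSubring C (invariantSubring J) :=
  fun α hα => ⟨α.2.1, fun _ hb x => hb α hα x⟩

theorem coidealAction_mul_invariant (hJ : ∀ v : V C, source C v ∈ J) {b : A}
    (hb : b ∈ invariantSubring J) (t : NCTensor (V C) A (toVSubmodule J hJ)) (x : A) :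
    coidealAction hJ t (x * b) = coidealAction hJ t x * b := by
  induction t using NCTensor.induction_on with
  | zero => simp
  | tmul a α => rw [coidealAction_tmul, coidealAction_tmul, hb α α.2, mul_assoc]
  | add s t hs ht => simp only [map_add, LinearMap.add_apply, hs, ht, add_mul]

/-- The condition `α(x) = α(1) x` extends from `J` to `A J`. Applied to the element `α(y -)` of `A
J`, it reads `α(y x) = α(y) x`. -/
theorem IsLeftCoidealSubring.coe_invariantSubring {h : IsD2 C} (hc : IsLeftCoidealSubring h J) :
    (invariantSubring J : Set A) = invariants J := by
  ext x
  constructor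
  · intro hx α hα
    rw [← hx α hα, one_mul]
  · intro hx α hα y
    have key : ∀ t : NCTensor (V C) A (toVSubmodule J hc.source_mem),
        coidealAction hc.source_mem t x = coidealAction hc.source_mem t 1 * x := fun t => by
      induction t using NCTensor.induction_on with
      | zero => simp
      | tmul a α => rw [coidealAction_tmul, coidealAction_tmul, hx α α.2, mul_assoc]
      | add s t hs ht => simp only [map_add, LinearMap.add_apply, hs, ht, add_mul]
    obtain ⟨s, hs⟩ := hc.exists_coidealAction hα y
    rw [← hs, key, hs, mul_one]

end Invariants

/-! ### The Jacobson–Bourbaki correspondence for the ring `A J` -/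

/-- The factorization of the identity is carried by `ε` to `D`, where dimension decides. This is
where the augmentation of `A` enters. -/
theorem card_le_of_mul_eq_one {A D : Type*} [Ring A] [DivisionRing D] (ε : A →+* D)
    {ι κ : Type*} [Fintype ι] [Fintype κ] [DecidableEq ι] (P : Matrix ι κ A) (Q : Matrix κ ι A)
    (h : P * Q = 1) : Fintype.card ι ≤ Fintype.card κ := by
  have h' : P.map ε * Q.map ε = 1 := by
    rw [← Matrix.map_mul, h, Matrix.map_one _ ε.map_zero ε.map_one]
  refine card_le_of_injective D
    ({ toFun := fun v => Matrix.vecMul v (P.map ε)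
       map_add' := fun v w => Matrix.add_vecMul _ v w
       map_smul' := fun r v => Matrix.smul_vecMul r v _ } : (ι → D) →ₗ[D] κ → D) ?_
  refine Function.LeftInverse.injective (g := fun w => Matrix.vecMul w (Q.map ε)) fun v => ?_
  change Matrix.vecMul (Matrix.vecMul v (P.map ε)) (Q.map ε) = v
  rw [Matrix.vecMul_vecMul, h', Matrix.vecMul_one]

section JacobsonBourbaki

variable {A : Type u} [Ring A] {C : Subring A} {J : Subring (S C)} {h : IsD2 C}

theorem IsGaloisLeftCoidealSubring.isSimpleModule [Nontrivial A]
    (hG : IsGaloisLeftCoidealSubring h J) : IsSimpleModule hG.smashRing A := by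
  rw [isSimpleModule_iff]
  refine { exists_pair_ne := ⟨⊥, ⊤, bot_ne_top⟩, eq_bot_or_eq_top := fun N => ?_ }
  let I : Ideal A :=
    { N with
      smul_mem' := fun a x hx => N.smul_mem ⟨_, hG.mulLeft_mem_smashRing a⟩ hx }
  have hmem : ∀ x, x ∈ I ↔ x ∈ N := fun x => Iff.rfl
  refine (hG.simple I fun α hα x hx => N.smul_mem ⟨_, hG.mem_smashRing hα⟩ hx).imp
    (fun hI => ?_) (fun hI => ?_)
  · ext x
    rw [← hmem, hI]
    simp
  · ext x
    rw [← hmem, hI]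
    simp

theorem IsLeftCoidealSubring.smashRing_apply_mul (hc : IsLeftCoidealSubring h J) {b : A}
    (hb : b ∈ invariantSubring J) {f : AddMonoid.End A} (hf : f ∈ hc.smashRing) (x : A) :
    f (x * b) = f x * b := by
  obtain ⟨t, ht⟩ := hf
  rw [← ht, ← ht, coidealAction_mul_invariant _ hb]

/-- Right multiplication by an invariant is linear over the ring `A J`. -/
def IsLeftCoidealSubring.mulRightLin (hc : IsLeftCoidealSubring h J) {b : A}
    (hb : b ∈ invariantSubring J) : A →ₗ[hc.smashRing] A where
  toFun x := x * b
  map_add' x y := add_mul x y b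
  map_smul' e x := (hc.smashRing_apply_mul hb e.2 x).symm

/-- `A J` contains all left multiplications, so its endomorphisms of `A` are right multiplications.
-/
theorem IsLeftCoidealSubring.end_apply (hc : IsLeftCoidealSubring h J)
    (φ : Module.End hc.smashRing A) (x : A) : φ x = x * φ 1 := by
  have := φ.map_smul ⟨_, hc.mulLeft_mem_smashRing x⟩ 1
  change φ (x * 1) = x * φ 1 at this
  rwa [mul_one] at this

theorem IsLeftCoidealSubring.end_apply_one_mem (hc : IsLeftCoidealSubring h J)
    (φ : Module.End hc.smashRing A) : φ 1 ∈ invariantSubring J := by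
  intro α hα x
  rw [← hc.end_apply φ x, ← hc.end_apply φ]
  exact (φ.map_smul ⟨_, hc.mem_smashRing hα⟩ x).symm

theorem IsGaloisLeftCoidealSubring.isDivisionSubring [Nontrivial A]
    (hG : IsGaloisLeftCoidealSubring h J) : IsDivisionSubring (invariantSubring J) := by
  refine ⟨one_ne_zero, fun b hb hb0 => ?_⟩
  have := hG.isSimpleModule
  -- Schur's lemma for right multiplication by `b`. Surjectivity yields the left inverse `y`;
  -- injectivity allows cancelling `b`, which shows that `y` is invariant and a right inverse.
  have hbij := (LinearMap.bijective_or_eq_zero (hG.mulRightLin hb)).resolve_right fun h0 =>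
    hb0 (by rw [← one_mul b]; exact LinearMap.congr_fun h0 1)
  have hinj : ∀ {x y : A}, x * b = y * b → x = y := fun hxy => hbij.1 hxy
  obtain ⟨y, hy⟩ : ∃ y, y * b = 1 := hbij.2 1
  refine ⟨y, fun α hα x => hinj ?_, hinj ?_, hy⟩
  · rw [← hb α hα, mul_assoc, hy, mul_assoc, hy, mul_one, mul_one]
  · rw [mul_assoc, hy, mul_one, one_mul]

/-- Jacobson density applies because a right `B`-linear map commutes with every `A J`-endomorphism,
these being right multiplications by elements of `B`. -/
theorem IsGaloisLeftCoidealSubring.exists_coidealAction_eq_on [Nontrivial A]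
    (hG : IsGaloisLeftCoidealSubring h J) (f : A →ₗ[(↥(invariantSubring J))ᵐᵒᵖ] A)
    (s : Finset A) : ∃ t, ∀ x ∈ s, coidealAction hG.source_mem t x = f x := by
  have := hG.isSimpleModule
  let F : Module.End (Module.End hG.smashRing A) A :=
    { toFun := f
      map_add' := f.map_add
      map_smul' := fun φ x => by
        change f (φ x) = φ (f x)
        rw [hG.end_apply φ x, hG.end_apply φ (f x)]
        exact map_mul_coe f x ⟨φ 1, hG.end_apply_one_mem φ⟩ }
  obtain ⟨⟨e, t, ht⟩, he⟩ := jacobson_density F s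
  exact ⟨t, fun x hx => (ht x).trans (he x hx).symm⟩

theorem IsGaloisLeftCoidealSubring.exists_generators (hG : IsGaloisLeftCoidealSubring h J) :
    ∃ (n : ℕ) (α : Fin n → toVSubmodule J hG.source_mem)
      (Φ : Fin n → NCTensor (V C) A (toVSubmodule J hG.source_mem) →+ A),
      (∀ i a t, Φ i (coidealLmul hG.source_mem a t) = a * Φ i t) ∧
      (∀ i c (hc : c ∈ C) t, Φ i (coidealRmul hG.source_mem c hc t) = Φ i t * c) ∧
      ∀ t x, coidealAction hG.source_mem t x =
        ∑ i, Φ i t * ((α i : S C) : AddMonoid.End A) x := by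
  have := hG.finite
  have := hG.projective
  obtain ⟨n, f, g, -, -, hfg⟩ := Module.Finite.exists_comp_eq_id_of_projective (V C)
    (toVSubmodule J hG.source_mem)
  -- With `g` the coordinates of a finite dual basis of `J`, `Φ i` is `a ⊗ α ↦ a g_i(α)`. It
  -- respects right multiplication by `C` because `g_i(α)` lies in `V`.
  refine ⟨n, fun i => f (Pi.single i 1), fun i => NCTensor.lift
    (AddMonoidHom.mk' (fun a => AddMonoidHom.mk' (fun α => a * (g α i : A))
      (fun α β => by rw [map_add, Pi.add_apply, Subring.coe_add, mul_add]))
      (fun a b => by ext α; exact add_mul a b _))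
    (fun a v α => by
      change a * (v : A) * (g α i : A) = a * (g (v • α) i : A)
      rw [map_smul, mul_assoc]
      rfl), fun i a t => ?_, fun i c hc t => ?_, fun t x => ?_⟩
  · induction t using NCTensor.induction_on with
    | zero => simp
    | tmul b α => exact mul_assoc a b _
    | add s t hs ht => simp only [map_add, hs, ht, mul_add]
  · induction t using NCTensor.induction_on with
    | zero => simp
    | tmul b α =>
      change b * c * (g α i : A) = b * (g α i : A) * c
      rw [mul_assoc, mul_assoc, Subring.mem_centralizer_iff.1 (g α i).2 c hc]
    | add s t hs ht => simp only [map_add, hs, ht, add_mul]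
  · induction t using NCTensor.induction_on with
    | zero => simp
    | tmul b α =>
      have hα : α = ∑ i, g α i • f (Pi.single i 1) := by
        simp_rw [← map_smul, ← map_sum]
        conv_lhs => rw [← LinearMap.id_apply (R := V C) α, ← hfg, LinearMap.comp_apply]
        congr 1
        ext j
        simp [Pi.single_apply]
      rw [coidealAction_tmul]
      change _ = ∑ i, b * (g α i : A) * _
      simp_rw [mul_assoc]
      rw [← Finset.mul_sum]
      congr 1
      conv_lhs => rw [hα]
      exact map_sum (AddMonoidHom.mk' (fun a : toVSubmodule J hG.source_mem =>
        ((a : S C) : AddMonoid.End A) x) (fun _ _ => rfl)) _ _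
    | add s t hs ht =>
      simp only [map_add, LinearMap.add_apply, hs, ht, add_mul, Finset.sum_add_distrib]

theorem IsGaloisLeftCoidealSubring.exists_dual_basis [Nontrivial A] {D : Type*} [DivisionRing D]
    (ε : A →+* D) (hG : IsGaloisLeftCoidealSubring h J) :
    ∃ (d : ℕ) (e : Fin d → A) (E : Fin d → A →ₗ[(↥(invariantSubring J))ᵐᵒᵖ] A),
      (∀ j x, E j x ∈ invariantSubring J) ∧ ∀ x, ∑ j, e j * E j x = x := by
  obtain ⟨n, α, Φ, -, -, hΦ⟩ := hG.exists_generators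
  let := hG.isDivisionSubring.divisionRing
  have hrank : Module.rank (↥(invariantSubring J))ᵐᵒᵖ A ≤ n := by
    refine rank_le fun s hs => ?_
    classical
    -- The `f j` are dual to the independent set `s`, and density realizes them on `s` by elements
    -- `t j` of `A ⊗_V J`. Writing these in the `n` generators factors the identity matrix of size
    -- `s` through size `n`.
    choose f hf using fun j : s =>
      hG.isDivisionSubring.exists_linearMap_of_linearIndependent hs (Pi.single j 1)
    choose t ht using fun j : s => hG.exists_coidealAction_eq_on (f j) s
    have := card_le_of_mul_eq_one ε (Matrix.of fun (j : s) (i : Fin n) => Φ i (t j))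
      (Matrix.of fun (i : Fin n) (k : s) => ((α i : S C) : AddMonoid.End A) (k : A)) (by
        ext j k
        rw [Matrix.mul_apply, Matrix.one_apply]
        refine (hΦ (t j) k).symm.trans ?_
        rw [ht j k k.2, hf, Pi.single_apply]
        exact if_congr eq_comm rfl rfl)
    simpa using this
  have : Module.Finite (↥(invariantSubring J))ᵐᵒᵖ A :=
    Module.rank_lt_aleph0_iff.1 (hrank.trans_lt (Cardinal.natCast_lt_aleph0))
  let b := Module.finBasis (↥(invariantSubring J))ᵐᵒᵖ A
  refine ⟨_, b, fun j => (subringEmbedding _).comp (b.coord j), fun j x => ?_, fun x => ?_⟩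
  · exact (unop (b.coord j x)).2
  · exact b.sum_repr x

/-- Once `A` is finitely generated over `B`, agreement on the generators `e j` is agreement
everywhere, and density gives the former. -/
theorem IsGaloisLeftCoidealSubring.exists_coidealAction_eq [Nontrivial A] {D : Type*}
    [DivisionRing D] (ε : A →+* D) (hG : IsGaloisLeftCoidealSubring h J)
    (f : A →ₗ[(↥(invariantSubring J))ᵐᵒᵖ] A) :
    ∃ t, ∀ x, coidealAction hG.source_mem t x = f x := by
  classical
  obtain ⟨d, e, E, hE, he⟩ := hG.exists_dual_basis ε
  obtain ⟨t, ht⟩ := hG.exists_coidealAction_eq_on f (Finset.univ.image e)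
  refine ⟨t, fun x => ?_⟩
  rw [← he x, map_sum, map_sum]
  refine Finset.sum_congr rfl fun j _ => ?_
  rw [coidealAction_mul_invariant _ (hE j x), ht _ (by simp)]
  exact (map_mul_coe f (e j) ⟨E j x, hE j x⟩).symm

theorem IsGaloisLeftCoidealSubring.endSubring_invariantSubring [Nontrivial A] {D : Type*}
    [DivisionRing D] (ε : A →+* D) (hff : RightFaithfullyFlat (V C) A)
    (hG : IsGaloisLeftCoidealSubring h J) : endSubring C (invariantSubring J) = J := by
  refine le_antisymm (fun α hα => ?_) le_endSubring_invariantSubring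
  let ι : toVSubmodule J hG.source_mem →ₗ[V C]
      toVSubmodule (endSubring C (invariantSubring J)) source_mem_endSubring :=
    Submodule.inclusion (le_endSubring_invariantSubring (J := J))
  have hι : ∀ t, coidealAction source_mem_endSubring
      (NCTensor.map (V C) (LinearMap.id : A →ₗ[(V C)ᵐᵒᵖ] A) ι t) =
        coidealAction hG.source_mem t := fun t => by
    induction t using NCTensor.induction_on with
    | zero => simp only [map_zero]
    | tmul a α => rfl
    | add s t hs ht => simp only [map_add, hs, ht]
  -- After tensoring with `A`, any `t` acts as a right `B`-linear map, hence as some `s` from `A ⊗_V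
  -- J`; injectivity of the action on `A ⊗_V End(_C A_B)` identifies `t` with the image of `s`.
  have hsurj : Function.Surjective ι := hff.surjective_of_map fun t => by
    let f : A →ₗ[(↥(invariantSubring J))ᵐᵒᵖ] A :=
      { toFun := coidealAction source_mem_endSubring t
        map_add' := map_add _
        map_smul' := fun b x => by
          refine coidealAction_mul_invariant _ (fun β hβ y => ?_) t x
          exact apply_mul_of_mem_endSubring hβ (unop b).2 y }
    obtain ⟨s, hs⟩ := hG.exists_coidealAction_eq ε f
    refine ⟨s, coidealAction_injective source_mem_endSubring h.left hff ?_⟩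
    rw [hι]
    exact LinearMap.ext hs
  obtain ⟨β, hβ⟩ := hsurj ⟨α, hα⟩
  have : (β : S C) = α := congrArg Subtype.val hβ
  rw [← this]
  exact β.2

/-! ### Left D3 quasibases for the ring of invariants. -/

/-- A dual basis of `A` over `B` recovers `t` as `∑ j, e j ⊗ E j(t¹) t²`, so identities in `A ⊗_B A`
may be tested by pairing with `End(A_B)`. -/
theorem pairing_ext {B : Subring A} {d : ℕ} {e : Fin d → A} {E : Fin d → A →ₗ[(↥B)ᵐᵒᵖ] A}
    (hE : ∀ j x, E j x ∈ B) (he : ∀ x, ∑ j, e j * E j x = x) {s t : TensorSq B}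
    (hst : ∀ f : A →ₗ[(↥B)ᵐᵒᵖ] A, pairing f s = pairing f t) : s = t := by
  have key : ∀ t : TensorSq B, t = ∑ j, NCTensor.tmul (↥B) (e j) (pairing (E j) t) := fun t => by
    induction t using NCTensor.induction_on with
    | zero =>
      simp only [map_zero]
      exact (Finset.sum_eq_zero fun j _ => map_zero
        (AddMonoidHom.mk' (NCTensor.tmul (↥B) (e j)) (NCTensor.tmul_add (↥B) (N := A) (e j)))).symm
    | tmul x y =>
      have h2 : ∀ j, NCTensor.tmul (↥B) (e j) (pairing (E j) (NCTensor.tmul (↥B) x y)) =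
          NCTensor.tmul (↥B) (e j * E j x) y := fun j =>
        (NCTensor.smul_tmul (⟨E j x, hE j x⟩ : B) (e j) y).symm
      simp_rw [h2]
      conv_lhs => rw [← he x]
      exact map_sum (AddMonoidHom.mk' (fun m : A => NCTensor.tmul (↥B) m y)
        fun m m' => NCTensor.add_tmul (↥B) m m' y) _ _
    | add s t hs ht =>
      simp only [map_add, NCTensor.tmul_add, Finset.sum_add_distrib, ← hs, ← ht]
  rw [key s, key t]
  simp only [hst]

theorem IsGaloisLeftCoidealSubring.isLeftD3 [Nontrivial A] {D : Type*}
    [DivisionRing D] (ε : A →+* D) (hff : RightFaithfullyFlat (V C) A)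
    (hG : IsGaloisLeftCoidealSubring h J) : IsLeftD3 C (invariantSubring J) := by
  obtain ⟨n, α, Φ, hΦl, hΦr, hΦ⟩ := hG.exists_generators
  obtain ⟨d, e, E, hE, he⟩ := hG.exists_dual_basis ε
  choose τ hτ using fun j => hG.exists_coidealAction_eq ε (E j)
  -- The `u i` are chosen so that pairing with `u i` is the coordinate `Φ i` on `End(A_B) ≅ A ⊗_V
  -- J`; it suffices to arrange this on the `E j`, since `f = ∑ j, f(e j) E j`.
  let u : Fin n → TensorSq (invariantSubring J) := fun i =>
    ∑ j, NCTensor.tmul _ (e j) (Φ i (τ j))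
  have hu : ∀ (f : A →ₗ[(↥(invariantSubring J))ᵐᵒᵖ] A) t,
      (∀ x, coidealAction hG.source_mem t x = f x) → ∀ i, pairing f (u i) = Φ i t := by
    intro f t hft i
    have ht : t = ∑ j, coidealLmul hG.source_mem (f (e j)) (τ j) := by
      refine coidealAction_injective hG.source_mem h.left hff (LinearMap.ext fun x => ?_)
      rw [hft, map_sum, LinearMap.sum_apply]
      conv_lhs => rw [← he x, map_sum]
      refine Finset.sum_congr rfl fun j _ => ?_
      rw [coidealAction_lmul, hτ]
      exact map_mul_coe f (e j) ⟨E j x, hE j x⟩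
    rw [ht, map_sum, map_sum]
    refine Finset.sum_congr rfl fun j _ => ?_
    rw [pairing_tmul, hΦl]
  refine LeftD3Quasibases.isLeftD3 ⟨n, fun i => (α i : S C),
    fun i => le_endSubring_invariantSubring (α i).2, u, fun i c hc => ?_, fun x y => ?_⟩
  -- Centrality of `u i`: precomposing `f` with left multiplication by `c` is right multiplication
  -- by `c` on the factor `A` of `A ⊗_V J`, and `Φ i` carries it to right multiplication on `A`.
  · refine pairing_ext hE he fun f => ?_
    obtain ⟨t, ht⟩ := hG.exists_coidealAction_eq ε f
    let g : A →ₗ[(↥(invariantSubring J))ᵐᵒᵖ] A :=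
      { toFun := fun x => f (c * x)
        map_add' := fun x y => by rw [mul_add, map_add]
        map_smul' := fun b x => by
          change f (c * (x * (unop b : invariantSubring J))) = f (c * x) * _
          rw [← mul_assoc, map_mul_coe]
          rfl }
    rw [pairing_congr (g := g) (a := 1) (fun x => (one_mul (f (c * x))).symm), one_mul,
      hu g (coidealRmul hG.source_mem c hc t) (fun x => by rw [coidealAction_rmul, ht]; rfl),
      hΦr, pairing_rmul, hu f t ht]
  · refine pairing_ext hE he fun f => ?_
    obtain ⟨t, ht⟩ := hG.exists_coidealAction_eq ε f
    rw [pairing_tmul, map_sum, ← ht, hΦ, Finset.sum_mul]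
    refine Finset.sum_congr rfl fun i _ => ?_
    rw [pairing_rmul, hu f t ht, mul_assoc]

theorem IsGaloisLeftCoidealSubring.isLeftD3IntermediateDivisionRing [Nontrivial A] {D : Type*}
    [DivisionRing D] (ε : A →+* D) (hff : RightFaithfullyFlat (V C) A)
    (hG : IsGaloisLeftCoidealSubring h J) :
    IsLeftD3IntermediateDivisionRing C (invariantSubring J) :=
  ⟨le_invariantSubring, hG.isDivisionSubring, hG.isLeftD3 ε hff⟩

end JacobsonBourbaki

/-! ### Order reversal and the bijection. -/

section Antitone

variable {A : Type u} [Ring A] {C : Subring A}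

theorem endSubring_antitone : Antitone (endSubring C) :=
  fun _ _ hB _ hα => ⟨hα.1, fun b hb => hα.2 b (hB hb)⟩

theorem invariantSubring_antitone : Antitone (invariantSubring (C := C)) :=
  fun _ _ hJ _ hb α hα => hb α (hJ hα)

theorem IsLeftD3IntermediateDivisionRing.invariantSubring_endSubring (h : IsD2 C) {B : Subring A}
    (hB : IsLeftD3IntermediateDivisionRing C B) : invariantSubring (endSubring C B) = B :=
  SetLike.coe_injective
    ((isLeftCoidealSubring_endSubring h).coe_invariantSubring.trans hB.invariants_endSubring)

end Antitone

end DepthThree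

theorem mainTheorem1 {A : Type u} [Ring A] {D : Type*} [DivisionRing D] (ε : A →+* D)
    (C : Subring A) (hC : DepthThree.IsDivisionSubring C) (hD2 : DepthThree.IsD2 C)
    (hff : DepthThree.RightFaithfullyFlat (DepthThree.V C) A) :
    ∃ Φ : {B : Subring A // DepthThree.IsLeftD3IntermediateDivisionRing C B} ≃o
        {J : Subring (DepthThree.S C) // DepthThree.IsGaloisLeftCoidealSubring hD2 J}ᵒᵈ,
      (∀ B, (OrderDual.ofDual (Φ B)).1.map (DepthThree.S C).subtype =
        DepthThree.bimodEnd C B.1) ∧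
      (∀ J, ((Φ.symm (OrderDual.toDual J)).1 : Set A) = DepthThree.invariants J.1) := by
  have : Nontrivial A := ⟨1, 0, hC.1⟩
  refine ⟨
    { toFun := fun B => OrderDual.toDual ⟨DepthThree.endSubring C B.1, B.2.isGalois hD2⟩
      invFun := fun J => ⟨DepthThree.invariantSubring (OrderDual.ofDual J).1,
        (OrderDual.ofDual J).2.isLeftD3IntermediateDivisionRing ε hff⟩
      left_inv := fun B => Subtype.ext (B.2.invariantSubring_endSubring hD2)
      right_inv := fun J => Subtype.ext
        ((OrderDual.ofDual J).2.endSubring_invariantSubring ε hff)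
      map_rel_iff' := fun {B B'} => ⟨fun hJ => ?_, fun hB => ?_⟩ },
    fun B => DepthThree.endSubring_map B.2.le, fun J => J.2.coe_invariantSubring⟩
  -- The order is reflected by taking invariants of both endomorphism rings, which returns `B` and
  -- `B'`.
  · have := DepthThree.invariantSubring_antitone (C := C) hJ
    change DepthThree.invariantSubring (DepthThree.endSubring C B.1) ≤
      DepthThree.invariantSubring (DepthThree.endSubring C B'.1) at this
    rwa [B.2.invariantSubring_endSubring hD2, B'.2.invariantSubring_endSubring hD2] at this
  · exact DepthThree.endSubring_antitone hB
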